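/- An MV-algebra is an algebra $(M,\oplus,\neg,0)$ of type $(2,1,0)$ such that $\oplus$ is commutative and associative with neutral element $0$, $\neg\neg x=x$, $x\oplus\neg 0=\neg 0$ and $\neg(\neg x\oplus y)\oplus y=\neg(\neg y\oplus x)\oplus x$ for all $x,y$. An embedding is an injective map preserving $\oplus$, $\neg$ and $0$. The interval $[0,1]\subseteq\mathbb R$ and its rational part $\mathbb Q\cap[0,1]$ are MV-algebras under $x\oplus y=\min(1,x+y)$ and $\neg x=1-x$; powers and ultrapowers carry the induced operations. An ultrafilter $U$ on a set $I$ is $\alpha$-regular if there is a set $E\subseteq U$ with $|E|=\alpha$ such that each $i\in I$ belongs to only finitely many $e\in E$. Let $\alpha$ be an infinite cardinal, regarded as a set of cardinality $\alpha$, and let $I$ be the set of all finite subsets of $\alpha$. There is an ultrafilter $U$ on $I$ such that $\{Y\in I : X\subseteq Y\}\in U$ for every $X\in I$. Let $U$ be any such ultrafilter. Then $U$ is $\alpha$-regular, and the following hold. 1. Every MV-algebra $M$ with more than one element and $|M|\le\alpha$ can be embedded into the ultrapower $\left(\prod_{X\in I}(\mathbb Q\cap[0,1])^{\mathbb N}\right)/U$.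 2. Every MV-algebra $M$ with more than one element and $|M|\le\alpha$ can be embedded into the ultrapower $\left(\prod_{X\in I}[0,1]^{\mathbb N}\right)/U$. 3. The ultrapower $\left(\prod_{X\in I}(\mathbb Q\cap[0,1])^{\mathbb N}\right)/U$ has cardinality $2^{\alpha}$. Consequently there is a single MV-algebra of cardinality $2^{\alpha}$ into which every MV-algebra with more than one element and of cardinality at most $\alpha$ can be embedded. -/

import Mathlib

open Cardinal Filter

universe u v

/-- An MV-algebra: an algebra `(A, ⊕, ¬, 0)` of type `(2, 1, 0)` satisfying the usual six axioms.
The unit is `1 := ¬0`. -/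
class MVAlgebra (A : Type u) extends Zero A where
  /-- the truncated addition `⊕` -/
  oplus : A → A → A
  /-- the negation `¬` -/
  neg : A → A
  oplus_comm : ∀ x y : A, oplus x y = oplus y x
  oplus_assoc : ∀ x y z : A, oplus x (oplus y z) = oplus (oplus x y) z
  oplus_zero : ∀ x : A, oplus x 0 = x
  neg_neg : ∀ x : A, neg (neg x) = x
  oplus_neg_zero : ∀ x : A, oplus x (neg 0) = neg 0
  lukasiewicz : ∀ x y : A,
    oplus (neg (oplus (neg x) y)) y = oplus (neg (oplus (neg y) x)) x

namespace MVAlgebra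

/-- The standard MV-algebra structure on the unit interval `[0, 1]` of an ordered field `R`
(`R = ℝ` gives `[0, 1]`, `R = ℚ` gives `ℚ ∩ [0, 1]`):
`x ⊕ y = min 1 (x + y)` and `¬x = 1 - x`. -/
noncomputable instance unitIcc (R : Type u) [Field R] [LinearOrder R] [IsStrictOrderedRing R] :
    MVAlgebra (Set.Icc (0 : R) 1) where
  oplus x y := ⟨min 1 (x.1 + y.1), le_min zero_le_one (add_nonneg x.2.1 y.2.1), min_le_left _ _⟩
  neg x := ⟨1 - x.1, sub_nonneg.2 x.2.2, sub_le_self _ x.2.1⟩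
  oplus_comm x y := Subtype.ext (by simp only [add_comm])
  oplus_assoc x y z := Subtype.ext (by
    obtain ⟨x, hx0, hx1⟩ := x
    obtain ⟨y, hy0, hy1⟩ := y
    obtain ⟨z, hz0, hz1⟩ := z
    simp only [min_def]
    split_ifs <;> linarith)
  oplus_zero x := Subtype.ext (by simpa using x.2.2)
  neg_neg x := Subtype.ext (by simp)
  oplus_neg_zero x := Subtype.ext (by simpa using x.2.1)
  lukasiewicz x y := Subtype.ext (by
    obtain ⟨x, hx0, hx1⟩ := x
    obtain ⟨y, hy0, hy1⟩ := y
    simp only [min_def]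
    split_ifs <;> linarith)

/-- Powers of an MV-algebra, with pointwise operations. -/
instance power (J : Type u) (A : Type v) [MVAlgebra A] : MVAlgebra (J → A) where
  oplus f g := fun j => oplus (f j) (g j)
  neg f := fun j => neg (f j)
  oplus_comm f g := funext fun j => oplus_comm (f j) (g j)
  oplus_assoc f g h := funext fun j => oplus_assoc (f j) (g j) (h j)
  oplus_zero f := funext fun j => oplus_zero (f j)
  neg_neg f := funext fun j => neg_neg (f j)
  oplus_neg_zero f := funext fun j => oplus_neg_zero (f j)
  lukasiewicz f g := funext fun j => lukasiewicz (f j) (g j)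

/-- The reduced power `(∏_{i ∈ I} A) / F`: the type `Filter.Germ F A` is the quotient of `I → A`
by the relation `{i | x i = y i} ∈ F`, and the operations are induced by the pointwise ones.
It is the ultrapower when `F` is an ultrafilter. -/
instance reducedPower (I : Type u) (F : Filter I) (A : Type v) [MVAlgebra A] :
    MVAlgebra (Germ F A) where
  oplus := Germ.map₂ oplus
  neg := Germ.map neg
  oplus_comm x y := Germ.inductionOn₂ x y fun f g =>
    congrArg _ (funext fun i => oplus_comm (f i) (g i))
  oplus_assoc x y z := Germ.inductionOn₃ x y z fun f g h =>
    congrArg _ (funext fun i => oplus_assoc (f i) (g i) (h i))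
  oplus_zero x := Germ.inductionOn x fun f =>
    congrArg _ (funext fun i => oplus_zero (f i))
  neg_neg x := Germ.inductionOn x fun f =>
    congrArg _ (funext fun i => neg_neg (f i))
  oplus_neg_zero x := Germ.inductionOn x fun f =>
    congrArg _ (funext fun i => oplus_neg_zero (f i))
  lukasiewicz x y := Germ.inductionOn₂ x y fun f g =>
    congrArg _ (funext fun i => lukasiewicz (f i) (g i))

/-- `A` embeds into `B`: there is an injective map preserving `⊕`, `¬` and `0`. -/
def Embeds (A : Type u) (B : Type v) [MVAlgebra A] [MVAlgebra B] : Prop :=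
  ∃ f : A → B, Function.Injective f ∧
    (∀ x y : A, f (oplus x y) = oplus (f x) (f y)) ∧
    (∀ x : A, f (neg x) = neg (f x)) ∧
    f 0 = 0

end MVAlgebra

/-- A filter `D` over `I` is `α`-regular if it is proper and there is a set `E ⊆ D` of
cardinality `α` such that each `i ∈ I` belongs to only finitely many `e ∈ E`. -/
def IsRegularFilter {I : Type u} (α : Cardinal.{u}) (D : Filter I) : Prop :=
  D.NeBot ∧ ∃ E : Set (Set I), E ⊆ D.sets ∧ #E = α ∧ ∀ i : I, {e ∈ E | i ∈ e}.Finite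

/-- A filter over the set of finite subsets of `κ` that contains all the sets
`{Y | X ⊆ Y}`, for `X` a finite subset of `κ`. -/
def ContainsCones {κ : Type u} (D : Filter (Finset κ)) : Prop :=
  ∀ X : Finset κ, {Y : Finset κ | X ⊆ Y} ∈ D

/-! The ultrapower turns a local statement into a global one. If each finite subset of `M` maps
injectively to `B`, respecting the operations, then `x` can be sent to the germ of the values at `x`
of these maps, where the index `X` selects the finite part of `M` coded in `X`. Injectivity and
preservation of each operation concern at most two elements at a time, so they hold once `X`
contains their codes, that is, on a set of `U` (`embeds_germ_of_partial`).

The local statement for `B = (ℚ ∩ [0,1]) ^ ℕ` reduces to separating two elements by a partial map to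
`ℚ ∩ [0,1]`, with one coordinate for each pair. A prime ideal gives a quotient that is a chain and
still separates them (`exists_chain_quotient`). A chain is the unit interval of a totally ordered
abelian group (`ChangGroup`). Finitely many positive elements of such a group stay positive under
some homomorphism to `ℚ` (`exists_addMonoidHom_pos`), and dividing by the image of the unit gives
the partial map.

For the cardinality, `(2 ^ ℵ₀) ^ α = 2 ^ α` bounds the ultrapower from above. From below, a function
`κ → Bool` is coded by the germ of its restrictions to finite sets. -/

namespace MVAlgebra

local infixl:65 " ⊕ₘ " => MVAlgebra.oplus
local prefix:max "∼" => MVAlgebra.neg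

/-! ### Natural order, residuation and lattice structure. -/

section Order

variable {A : Type u} [MVAlgebra A]

instance : Std.Commutative (oplus : A → A → A) := ⟨oplus_comm⟩

instance : Std.Associative (oplus : A → A → A) := ⟨fun x y z => (oplus_assoc x y z).symm⟩

theorem zero_oplus (x : A) : 0 ⊕ₘ x = x := by rw [oplus_comm, oplus_zero]

theorem neg_zero_oplus (x : A) : ∼0 ⊕ₘ x = ∼0 := by rw [oplus_comm, oplus_neg_zero]

theorem neg_oplus_self (x : A) : ∼x ⊕ₘ x = ∼0 := by
  have h := lukasiewicz x (∼0)
  rw [oplus_neg_zero, neg_neg, zero_oplus] at h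
  exact h.symm

theorem neg_inj {x y : A} (h : ∼x = ∼y) : x = y := by
  rw [← neg_neg x, h, neg_neg]

theorem neg_oplus_eq_iff_exists {x y : A} : ∼x ⊕ₘ y = ∼0 ↔ ∃ z, x ⊕ₘ z = y := by
  constructor
  · intro h
    -- The witness is the truncated difference of `y` and `x`.
    refine ⟨∼(∼y ⊕ₘ x), ?_⟩
    have := lukasiewicz x y
    rw [h, neg_neg, zero_oplus] at this
    rw [oplus_comm, ← this]
  · rintro ⟨z, rfl⟩
    rw [oplus_assoc, neg_oplus_self, neg_zero_oplus]

/-- The natural order of an MV-algebra: `x ≤ y` means `¬x ⊕ y = 1`. -/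
@[reducible] def toPartialOrder : PartialOrder A where
  le x y := ∼x ⊕ₘ y = ∼0
  le_refl := neg_oplus_self
  le_trans x y z hxy hyz := by
    obtain ⟨a, rfl⟩ := neg_oplus_eq_iff_exists.1 hxy
    obtain ⟨b, rfl⟩ := neg_oplus_eq_iff_exists.1 hyz
    exact neg_oplus_eq_iff_exists.2 ⟨a ⊕ₘ b, oplus_assoc _ _ _⟩
  le_antisymm x y hxy hyx := by
    have := lukasiewicz x y
    rw [hxy, hyx, neg_neg, zero_oplus, zero_oplus] at this
    exact this.symm

attribute [local instance] toPartialOrder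

theorem le_def {x y : A} : x ≤ y ↔ ∼x ⊕ₘ y = ∼0 := Iff.rfl

theorem le_iff_exists_oplus {x y : A} : x ≤ y ↔ ∃ z, x ⊕ₘ z = y := neg_oplus_eq_iff_exists

theorem zero_le (x : A) : 0 ≤ x := neg_zero_oplus x

theorem le_neg_zero (x : A) : x ≤ ∼0 := oplus_neg_zero _

theorem le_oplus_right (x y : A) : x ≤ x ⊕ₘ y := le_iff_exists_oplus.2 ⟨y, rfl⟩

theorem le_oplus_left (x y : A) : y ≤ x ⊕ₘ y := oplus_comm x y ▸ le_oplus_right y x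

theorem oplus_le_oplus_right {x y : A} (h : x ≤ y) (z : A) : x ⊕ₘ z ≤ y ⊕ₘ z := by
  obtain ⟨a, rfl⟩ := le_iff_exists_oplus.1 h
  refine le_iff_exists_oplus.2 ⟨a, ?_⟩
  rw [← oplus_assoc, ← oplus_assoc, oplus_comm z a]

theorem oplus_le_oplus_left {x y : A} (h : x ≤ y) (z : A) : z ⊕ₘ x ≤ z ⊕ₘ y := by
  rw [oplus_comm z x, oplus_comm z y]
  exact oplus_le_oplus_right h z

theorem oplus_le_oplus {x y z w : A} (h : x ≤ y) (h' : z ≤ w) : x ⊕ₘ z ≤ y ⊕ₘ w :=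
  (oplus_le_oplus_right h z).trans (oplus_le_oplus_left h' y)

theorem neg_le_neg {x y : A} (h : x ≤ y) : ∼y ≤ ∼x := by
  rw [le_def, neg_neg, oplus_comm]
  exact h

theorem le_neg_comm {x y : A} (h : x ≤ ∼y) : y ≤ ∼x := by
  simpa only [neg_neg] using neg_le_neg h

theorem neg_le_comm {x y : A} (h : ∼x ≤ y) : ∼y ≤ x := by
  simpa only [neg_neg] using neg_le_neg h

/-- Truncated subtraction `x ⊖ y = ¬(¬x ⊕ y)`. -/
def sub (x y : A) : A := ∼(∼x ⊕ₘ y)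

local infixl:65 " ⊖ " => MVAlgebra.sub

/-- Residuation: subtracting `y` is left adjoint to adding `y`. This is why `⊕` distributes over
meets in `oplus_inf`. -/
theorem sub_le_iff {x y z : A} : x ⊖ y ≤ z ↔ x ≤ y ⊕ₘ z := by
  rw [le_def, le_def, sub, neg_neg, oplus_assoc]

theorem sub_le_sub {x y z w : A} (h : x ≤ y) (h' : w ≤ z) : x ⊖ z ≤ y ⊖ w :=
  neg_le_neg (oplus_le_oplus (neg_le_neg h) h')

theorem sub_le_self (x y : A) : x ⊖ y ≤ x := sub_le_iff.2 (le_oplus_left y x)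

theorem sub_le_neg (x y : A) : x ⊖ y ≤ ∼y := neg_le_neg (le_oplus_left _ _)

theorem le_sub_oplus (x y : A) : x ≤ (x ⊖ y) ⊕ₘ y := by
  rw [oplus_comm]
  exact sub_le_iff.1 le_rfl

theorem sub_oplus_cancel {x y : A} (h : y ≤ x) : (x ⊖ y) ⊕ₘ y = x := by
  have := lukasiewicz x y
  rwa [le_def.1 h, neg_neg, zero_oplus] at this

theorem sub_eq_zero_iff {x y : A} : x ⊖ y = 0 ↔ x ≤ y := by
  rw [le_def, sub]
  constructor
  · intro h
    rw [← neg_neg (∼x ⊕ₘ y), h]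
  · intro h
    rw [h, neg_neg]

theorem sub_sub (x y z : A) : x ⊖ y ⊖ z = x ⊖ (y ⊕ₘ z) := by
  simp only [sub, neg_neg, oplus_assoc]

theorem neg_sub_neg (x y : A) : ∼x ⊖ ∼y = y ⊖ x := by
  simp only [sub, neg_neg, oplus_comm]

theorem neg_zero_sub (x : A) : ∼0 ⊖ x = ∼x := by
  simp only [sub, neg_neg, zero_oplus]

theorem sub_neg_comm (x y : A) : x ⊖ ∼y = y ⊖ ∼x := by
  simp only [sub, oplus_comm]

theorem oplus_sub_cancel {x z : A} (h : x ≤ ∼z) : (x ⊕ₘ z) ⊖ z = x := by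
  have h1 := sub_oplus_cancel (le_neg_comm h)
  refine neg_inj ?_
  rw [← h1]
  simp only [sub, neg_neg]

theorem oplus_right_cancel {x y z : A} (hx : x ≤ ∼z) (hy : y ≤ ∼z) (h : x ⊕ₘ z = y ⊕ₘ z) :
    x = y := by
  rw [← oplus_sub_cancel hx, h, oplus_sub_cancel hy]

/-- The natural order of an MV-algebra is a lattice order, with `x ∨ y = (x ⊖ y) ⊕ y`. -/
@[reducible] def toLattice : Lattice A where
  __ := (toPartialOrder : PartialOrder A)
  sup x y := (x ⊖ y) ⊕ₘ y
  inf x y := ∼((∼x ⊖ ∼y) ⊕ₘ ∼y)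
  le_sup_left x y := le_sub_oplus x y
  le_sup_right x y := le_oplus_left _ _
  sup_le x y z hx hy := by
    rw [← sub_oplus_cancel hy]
    exact oplus_le_oplus_right (sub_le_sub hx le_rfl) y
  inf_le_left x y := neg_le_comm (le_sub_oplus _ _)
  inf_le_right x y := neg_le_comm (le_oplus_left _ _)
  le_inf x y z hx hy := by
    refine le_neg_comm ?_
    rw [← sub_oplus_cancel (neg_le_neg hy)]
    exact oplus_le_oplus_right (sub_le_sub (neg_le_neg hx) le_rfl) _

attribute [local instance] toLattice

theorem oplus_inf (x y z : A) : x ⊕ₘ (y ⊓ z) = (x ⊕ₘ y) ⊓ (x ⊕ₘ z) := by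
  refine le_antisymm (le_inf (oplus_le_oplus_left inf_le_left x)
    (oplus_le_oplus_left inf_le_right x)) ?_
  exact sub_le_iff.1 (le_inf (sub_le_iff.2 inf_le_left) (sub_le_iff.2 inf_le_right))

/-- Adding `m = x ⊓ y` to `(x ⊖ m) ⊓ (y ⊖ m)` gives back `m`, so cancellation makes that meet zero,
and it dominates the one claimed. This identity is what makes prime quotients total. -/
theorem sub_inf_sub (x y : A) : (x ⊖ y) ⊓ (y ⊖ x) = 0 := by
  set m := x ⊓ y with hm
  have h : (x ⊖ m) ⊓ (y ⊖ m) = 0 := by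
    refine oplus_right_cancel (z := m) (inf_le_left.trans (sub_le_neg x m)) (zero_le _) ?_
    rw [oplus_comm, oplus_inf, oplus_comm m, oplus_comm m, sub_oplus_cancel inf_le_left,
      sub_oplus_cancel inf_le_right, zero_oplus]
  refine le_antisymm ?_ (zero_le _)
  rw [← h]
  exact inf_le_inf (sub_le_sub le_rfl inf_le_right) (sub_le_sub le_rfl inf_le_left)

theorem inf_oplus_eq_zero {x y z : A} (hy : x ⊓ y = 0) (hz : x ⊓ z = 0) : x ⊓ (y ⊕ₘ z) = 0 := by
  refine le_antisymm ?_ (zero_le _)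
  have h : (x ⊓ y) ⊕ₘ (x ⊓ z) = 0 := by rw [hy, hz, oplus_zero]
  rw [← h, oplus_inf]
  refine le_inf (inf_le_left.trans (le_oplus_left _ _)) ?_
  rw [oplus_comm (x ⊓ y) z, oplus_inf]
  refine le_inf (inf_le_left.trans (le_oplus_left _ _)) ?_
  rw [oplus_comm z y]
  exact inf_le_right

end Order

/-! ### Ideals, prime ideals and chain quotients. -/

section Ideal

variable {A : Type u} [MVAlgebra A]

attribute [local instance] toLattice
local infixl:65 " ⊖ " => MVAlgebra.sub

/-- Ideals of an MV-algebra: down-closed sets containing `0` and closed under `⊕`. -/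
structure IsIdeal (I : Set A) : Prop where
  zero_mem : 0 ∈ I
  oplus_mem : ∀ {x y}, x ∈ I → y ∈ I → x ⊕ₘ y ∈ I
  mem_of_le : ∀ {x y}, x ≤ y → y ∈ I → x ∈ I

/-- The `n`-fold sum `x ⊕ ⋯ ⊕ x`. -/
def multiple (x : A) : ℕ → A
  | 0 => 0
  | n + 1 => multiple x n ⊕ₘ x

theorem multiple_add (x : A) (m n : ℕ) : multiple x (m + n) = multiple x m ⊕ₘ multiple x n := by
  induction n with
  | zero => exact (oplus_zero _).symm
  | succ n ih => rw [← add_assoc, multiple, ih, multiple, oplus_assoc]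

theorem inf_multiple_eq_zero {x y : A} (h : x ⊓ y = 0) (n : ℕ) : x ⊓ multiple y n = 0 := by
  induction n with
  | zero => exact le_antisymm inf_le_right (zero_le _)
  | succ n ih => exact inf_oplus_eq_zero ih h

theorem multiple_inf_multiple_eq_zero {x y : A} (h : x ⊓ y = 0) (m n : ℕ) :
    multiple x m ⊓ multiple y n = 0 := by
  refine inf_multiple_eq_zero ?_ n
  rw [inf_comm] at h ⊢
  exact inf_multiple_eq_zero h m

/-- The ideal generated by an ideal `I` and an element `x`. -/
def adjoin (I : Set A) (x : A) : Set A := {z | ∃ p ∈ I, ∃ n, z ≤ p ⊕ₘ multiple x n}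

theorem IsIdeal.adjoin {I : Set A} (hI : IsIdeal I) (x : A) : IsIdeal (adjoin I x) where
  zero_mem := ⟨0, hI.zero_mem, 0, zero_le _⟩
  oplus_mem := by
    rintro a b ⟨p, hp, m, ha⟩ ⟨q, hq, n, hb⟩
    refine ⟨p ⊕ₘ q, hI.oplus_mem hp hq, m + n, (oplus_le_oplus ha hb).trans_eq ?_⟩
    rw [multiple_add]
    ac_rfl
  mem_of_le := by
    rintro a b hab ⟨p, hp, m, hb⟩
    exact ⟨p, hp, m, hab.trans hb⟩

/-- Zorn's lemma gives an ideal `P` maximal among those missing `c`. If both differences lay outside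
`P`, then `c` would be below `p ⊕ m(x ⊖ y)` and `q ⊕ n(y ⊖ x)` with `p, q ∈ P`. The two multiples
have meet zero, so `c ≤ p ⊕ q`, which lies in `P`. -/
theorem exists_prime_ideal {c : A} (hc : c ≠ 0) :
    ∃ I : Set A, IsIdeal I ∧ c ∉ I ∧ ∀ x y : A, x ⊖ y ∈ I ∨ y ⊖ x ∈ I := by
  have h0 : ({0} : Set A) ∈ {I : Set A | IsIdeal I ∧ c ∉ I} := by
    refine ⟨⟨rfl, ?_, ?_⟩, hc⟩
    · rintro x y rfl rfl
      exact oplus_zero _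
    · rintro x y hxy rfl
      exact le_antisymm hxy (zero_le _)
  obtain ⟨P, -, hP⟩ := zorn_subset_nonempty {I : Set A | IsIdeal I ∧ c ∉ I} (by
    rintro S hS hchain ⟨I₀, hI₀⟩
    refine ⟨⋃₀ S, ⟨⟨⟨I₀, hI₀, (hS hI₀).1.zero_mem⟩, ?_, ?_⟩, ?_⟩, fun I => Set.subset_sUnion_of_mem⟩
    · rintro x y ⟨I, hI, hx⟩ ⟨J, hJ, hy⟩
      rcases hchain.total hI hJ with h | h
      · exact ⟨J, hJ, (hS hJ).1.oplus_mem (h hx) hy⟩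
      · exact ⟨I, hI, (hS hI).1.oplus_mem hx (h hy)⟩
    · rintro x y hxy ⟨I, hI, hy⟩
      exact ⟨I, hI, (hS hI).1.mem_of_le hxy hy⟩
    · rintro ⟨I, hI, h⟩
      exact (hS hI).2 h) _ h0
  obtain ⟨⟨hPI, hcP⟩, hmax⟩ := hP
  refine ⟨P, hPI, hcP, fun x y => ?_⟩
  have key : ∀ z ∉ P, c ∈ adjoin P z := by
    intro z hz
    by_contra hcz
    refine hz (hmax ⟨hPI.adjoin z, hcz⟩ ?_ ⟨0, hPI.zero_mem, 1, ?_⟩)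
    · exact fun p hp => ⟨p, hp, 0, le_oplus_right _ _⟩
    · simp only [multiple, zero_oplus, le_refl]
  by_contra! h
  obtain ⟨p, hp, m, hpm⟩ := key _ h.1
  obtain ⟨q, hq, n, hqn⟩ := key _ h.2
  refine hcP (hPI.mem_of_le ?_ (hPI.oplus_mem hp hq))
  have h1 := oplus_inf (p ⊕ₘ q) (multiple (x ⊖ y) m) (multiple (y ⊖ x) n)
  rw [multiple_inf_multiple_eq_zero (sub_inf_sub x y), oplus_zero] at h1
  rw [h1]
  exact le_inf (hpm.trans (oplus_le_oplus_right (le_oplus_right _ _) _))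
    (hqn.trans (oplus_le_oplus_right (le_oplus_left _ _) _))

/-- The congruence of an ideal. -/
def IsIdeal.setoid {I : Set A} (hI : IsIdeal I) : Setoid A where
  r x y := x ⊖ y ∈ I ∧ y ⊖ x ∈ I
  iseqv := by
    have htrans : ∀ {x y z}, x ⊖ y ∈ I → y ⊖ z ∈ I → x ⊖ z ∈ I := by
      intro x y z hxy hyz
      refine hI.mem_of_le (sub_le_iff.2 ((le_sub_oplus x y).trans ?_)) (hI.oplus_mem hxy hyz)
      rw [oplus_comm z, ← oplus_assoc]
      exact oplus_le_oplus_left (le_sub_oplus y z) _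
    refine ⟨fun x => ?_, fun h => ⟨h.2, h.1⟩, fun h h' => ⟨htrans h.1 h'.1, htrans h'.2 h.2⟩⟩
    rw [sub_eq_zero_iff.2 le_rfl]
    exact ⟨hI.zero_mem, hI.zero_mem⟩

theorem oplus_sub_oplus_le (x x' y y' : A) : (x ⊕ₘ y) ⊖ (x' ⊕ₘ y') ≤ (x ⊖ x') ⊕ₘ (y ⊖ y') := by
  refine sub_le_iff.2 ((oplus_le_oplus (le_sub_oplus x x') (le_sub_oplus y y')).trans_eq ?_)
  ac_rfl

/-- The quotient of an MV-algebra by an ideal. -/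
@[reducible] def IsIdeal.quotient {I : Set A} (hI : IsIdeal I) :
    MVAlgebra (Quotient hI.setoid) where
  zero := Quotient.mk hI.setoid 0
  oplus := Quotient.map₂ oplus (by
    rintro x x' ⟨hx, hx'⟩ y y' ⟨hy, hy'⟩
    exact ⟨hI.mem_of_le (oplus_sub_oplus_le _ _ _ _) (hI.oplus_mem hx hy),
      hI.mem_of_le (oplus_sub_oplus_le _ _ _ _) (hI.oplus_mem hx' hy')⟩)
  neg := Quotient.map neg (by
    rintro x y ⟨hx, hy⟩
    refine ⟨?_, ?_⟩ <;> rwa [neg_sub_neg])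
  oplus_comm x y := Quotient.inductionOn₂ x y fun _ _ => congrArg _ (oplus_comm _ _)
  oplus_assoc x y z := Quotient.inductionOn₃ x y z fun _ _ _ => congrArg _ (oplus_assoc _ _ _)
  oplus_zero x := Quotient.inductionOn x fun _ => congrArg _ (oplus_zero _)
  neg_neg x := Quotient.inductionOn x fun _ => congrArg _ (neg_neg _)
  oplus_neg_zero x := Quotient.inductionOn x fun _ => congrArg _ (oplus_neg_zero _)
  lukasiewicz x y := Quotient.inductionOn₂ x y fun _ _ => congrArg _ (lukasiewicz _ _)

theorem exists_chain_quotient {a b : A} (hab : a ≠ b) :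
    ∃ (C : Type u) (_ : MVAlgebra C) (π : A → C), (∀ x y : C, x ≤ y ∨ y ≤ x) ∧
      (∀ x y, π (x ⊕ₘ y) = π x ⊕ₘ π y) ∧ (∀ x, π ∼x = ∼(π x)) ∧ π 0 = 0 ∧ π a ≠ π b := by
  wlog h : ¬ a ≤ b generalizing a b
  · obtain ⟨C, i, π, h1, h2, h3, h4, h5⟩ :=
      this hab.symm fun hba => hab (le_antisymm (not_not.1 h) hba)
    exact ⟨C, i, π, h1, h2, h3, h4, h5.symm⟩
  -- The ideal is chosen to miss `a ⊖ b`, which is nonzero because `a ≤ b` fails.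
  obtain ⟨I, hI, hc, hprime⟩ := exists_prime_ideal (fun h0 => h (sub_eq_zero_iff.1 h0))
  refine ⟨Quotient hI.setoid, hI.quotient, Quotient.mk hI.setoid, ?_, fun _ _ => rfl,
    fun _ => rfl, rfl, fun h => hc (Quotient.exact h).1⟩
  let _ := hI.quotient
  have key : ∀ x y : A, x ⊖ y ∈ I →
      (Quotient.mk hI.setoid x : Quotient hI.setoid) ⊖ Quotient.mk hI.setoid y = 0 := by
    intro x y hxy
    refine Quotient.sound ⟨?_, ?_⟩
    · exact hI.mem_of_le (sub_le_self _ _) hxy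
    · exact hI.mem_of_le (sub_le_self _ _) hI.zero_mem
  intro x y
  induction x, y using Quotient.inductionOn₂ with
  | h x y => 
    rcases hprime x y with h | h
    · exact Or.inl (sub_eq_zero_iff.1 (key x y h))
    · exact Or.inr (sub_eq_zero_iff.1 (key y x h))

end Ideal

end MVAlgebra

/-! ### Rational functionals on ordered groups. -/

section LinearOrder

variable {V : Type*} [AddCommGroup V] [LinearOrder V] [IsOrderedAddMonoid V] [Module ℚ V]
  [PosSMulStrictMono ℚ V]

theorem linearCombination_fin_succ {W : Type*} [AddCommGroup W] [Module ℚ W] {n : ℕ}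
    (x : Fin (n + 1) → W) (v : Fin (n + 1) → ℚ) :
    Fintype.linearCombination ℚ x v =
      v 0 • x 0 + Fintype.linearCombination ℚ (Fin.tail x) (Fin.tail v) := by
  simp only [Fintype.linearCombination_apply, Fin.sum_univ_succ, Fin.tail]

/-- Fourier–Motzkin elimination: finitely many coordinate vectors that a family of vectors of an
ordered space maps to positive elements are positive under a single rational functional. -/
theorem exists_linearCombination_pos {n : ℕ} (x : Fin n → V) (S : Finset (Fin n → ℚ))
    (hS : ∀ s ∈ S, 0 < Fintype.linearCombination ℚ x s) :
    ∃ g : Fin n → ℚ, ∀ s ∈ S, 0 < Fintype.linearCombination ℚ g s := by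
  classical
  induction n with
  | zero =>
    refine ⟨0, fun s hs => ?_⟩
    have := hS s hs
    simp [Fintype.linearCombination_apply] at this
  | succ n ih =>
    let S₀ := S.filter fun s => s 0 = 0
    let S₁ := S.filter fun s => 0 < s 0
    let S₂ := S.filter fun s => s 0 < 0
    -- Eliminate coordinate `0`: constraints not involving it are kept, and each pair with opposite
    -- signs there is combined positively so that it cancels.
    obtain ⟨g, hg⟩ := ih (Fin.tail x) (S₀.image Fin.tail ∪
        (S₁ ×ˢ S₂).image fun p => p.1 0 • Fin.tail p.2 - p.2 0 • Fin.tail p.1) (by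
      intro v hv
      simp only [Finset.mem_union, Finset.mem_image, Prod.exists, Finset.mem_product] at hv
      rcases hv with ⟨s, hs, rfl⟩ | ⟨s, t, ⟨hs, ht⟩, rfl⟩
      · obtain ⟨hs, h0⟩ := Finset.mem_filter.1 hs
        have := hS s hs
        rwa [linearCombination_fin_succ, h0, zero_smul, zero_add] at this
      · obtain ⟨hs, hs0⟩ := Finset.mem_filter.1 hs
        obtain ⟨ht, ht0⟩ := Finset.mem_filter.1 ht
        have h := add_pos (smul_pos hs0 (hS t ht)) (smul_pos (neg_pos.2 ht0) (hS s hs))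
        rw [linearCombination_fin_succ, linearCombination_fin_succ x] at h
        rw [map_sub, map_smul, map_smul]
        convert h using 1
        module)
    -- Constraints with `s 0 > 0` are lower bounds for the new value `c`, those with `s 0 < 0` upper
    -- bounds. The combined constraints say that each lower bound is less than each upper bound.
    obtain ⟨c, hc₁, hc₂⟩ := Order.exists_between_finsets
      (S₁.image fun s => -(Fintype.linearCombination ℚ g (Fin.tail s)) / s 0)
      (S₂.image fun s => -(Fintype.linearCombination ℚ g (Fin.tail s)) / s 0) (by
        intro a ha b hb
        obtain ⟨s, hs, rfl⟩ := Finset.mem_image.1 ha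
        obtain ⟨t, ht, rfl⟩ := Finset.mem_image.1 hb
        have h := hg _ (Finset.mem_union_right _
          (Finset.mem_image_of_mem _ (Finset.mk_mem_product hs ht)))
        have hs0 := (Finset.mem_filter.1 hs).2
        have ht0 := (Finset.mem_filter.1 ht).2
        simp only [map_sub, map_smul, smul_eq_mul] at h
        rw [div_lt_iff₀ hs0, div_mul_eq_mul_div, lt_div_iff_of_neg ht0]
        linarith)
    refine ⟨Fin.cons c g, fun s hs => ?_⟩
    rw [linearCombination_fin_succ, Fin.cons_zero, Fin.tail_cons, smul_eq_mul]
    rcases lt_trichotomy (s 0) 0 with h0 | h0 | h0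
    · have := hc₂ _ (Finset.mem_image_of_mem _ (Finset.mem_filter.2 ⟨hs, h0⟩))
      rw [lt_div_iff_of_neg h0] at this
      linarith
    · rw [h0, zero_mul, zero_add]
      exact hg _ (Finset.mem_union_left _
        (Finset.mem_image_of_mem _ (Finset.mem_filter.2 ⟨hs, h0⟩)))
    · have := hc₁ _ (Finset.mem_image_of_mem _ (Finset.mem_filter.2 ⟨hs, h0⟩))
      rw [div_lt_iff₀ h0] at this
      linarith

/-- In a basis of the finite-dimensional span of `T` this is the coordinate statement; the
functional found there extends to all of `V`. -/
theorem exists_linearMap_pos (T : Finset V) (hT : ∀ t ∈ T, 0 < t) :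
    ∃ φ : V →ₗ[ℚ] ℚ, ∀ t ∈ T, 0 < φ t := by
  classical
  let W := Submodule.span ℚ (T : Set V)
  have : Module.Finite ℚ W := Module.Finite.span_of_finite ℚ T.finite_toSet
  let b := Module.finBasis ℚ W
  have hmem : ∀ t ∈ T, t ∈ W := fun t ht => Submodule.subset_span ht
  obtain ⟨g, hg⟩ := exists_linearCombination_pos (fun i => (b i : V))
    (T.attach.image fun t : {t // t ∈ T} => ⇑(b.repr ⟨t.1, hmem t.1 t.2⟩)) (by
      intro s hs
      obtain ⟨t, -, rfl⟩ := Finset.mem_image.1 hs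
      have h := congrArg (Subtype.val : W → V) (b.sum_repr ⟨t.1, hmem t.1 t.2⟩)
      simp only [Submodule.coe_sum, Submodule.coe_smul] at h
      rw [Fintype.linearCombination_apply, h]
      exact hT t.1 t.2)
  obtain ⟨φ, hφ⟩ := LinearMap.exists_extend (b.constr ℚ g)
  refine ⟨φ, fun t ht => ?_⟩
  have h := LinearMap.congr_fun hφ ⟨t, hmem t ht⟩
  rw [LinearMap.comp_apply, Submodule.subtype_apply, Module.Basis.constr_apply_fintype (S := ℚ)] at h
  rw [h]
  exact hg _ (Finset.mem_image_of_mem _ (T.mem_attach ⟨t, ht⟩))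

/-- The divisible hull is an ordered rational vector space containing `G`; restrict a functional
from there. -/
theorem exists_addMonoidHom_pos {G : Type*} [AddCommGroup G] [LinearOrder G]
    [IsOrderedAddMonoid G] (T : Finset G) (hT : ∀ t ∈ T, 0 < t) :
    ∃ φ : G →+ ℚ, ∀ t ∈ T, 0 < φ t := by
  classical
  obtain ⟨φ, hφ⟩ := exists_linearMap_pos (T.image (DivisibleHull.coeAddMonoidHom G)) (by
    intro v hv
    obtain ⟨t, ht, rfl⟩ := Finset.mem_image.1 hv
    have hmono := (DivisibleHull.coeOrderAddMonoidHom G).monotone'.strictMono_of_injective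
      DivisibleHull.coe_injective
    have := hmono (hT t ht)
    simpa using this)
  exact ⟨φ.toAddMonoidHom.comp (DivisibleHull.coeAddMonoidHom G),
    fun t ht => hφ _ (Finset.mem_image_of_mem _ ht)⟩

end LinearOrder

namespace MVAlgebra

local infixl:65 " ⊕ₘ " => MVAlgebra.oplus
local prefix:max "∼" => MVAlgebra.neg
local infixl:65 " ⊖ " => MVAlgebra.sub
attribute [local instance] toLattice

/-! ### The product and its mixed associativity laws. -/

section Product

variable {A : Type u} [MVAlgebra A]

/-- The product `x ⊙ y = ¬(¬x ⊕ ¬y)`. -/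
def odot (x y : A) : A := x ⊖ ∼y

local infixl:70 " ⊙ₘ " => MVAlgebra.odot

theorem neg_odot (x y : A) : ∼(x ⊙ₘ y) = ∼x ⊕ₘ ∼y := by
  simp only [odot, sub, neg_neg]

theorem neg_oplus (x y : A) : ∼(x ⊕ₘ y) = ∼x ⊙ₘ ∼y := by
  simp only [odot, sub, neg_neg]

theorem odot_comm (x y : A) : x ⊙ₘ y = y ⊙ₘ x := sub_neg_comm x y

theorem odot_assoc (x y z : A) : x ⊙ₘ y ⊙ₘ z = x ⊙ₘ (y ⊙ₘ z) :=
  neg_inj (by simp only [neg_odot, oplus_assoc])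

theorem odot_le_left (x y : A) : x ⊙ₘ y ≤ x := sub_le_self _ _

theorem neg_zero_odot (x : A) : ∼0 ⊙ₘ x = x := by rw [odot, neg_zero_sub, neg_neg]

theorem oplus_eq_neg_zero_iff {x y : A} : x ⊕ₘ y = ∼0 ↔ ∼x ≤ y := by rw [le_def, neg_neg]

theorem neg_odot_self (x : A) : ∼x ⊙ₘ x = 0 := sub_eq_zero_iff.2 le_rfl

/-- This law and the next two are associativity of Chang's addition, one for each carry pattern.
Read in `[0,1]`, the hypotheses say `a + b ≥ 1` and `b + c ≤ 1`, and both sides equal `a + b + c -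
1`. -/
theorem odot_oplus_of_le {a b c : A} (hab : ∼a ≤ b) (hbc : b ≤ ∼c) :
    a ⊙ₘ b ⊕ₘ c = a ⊙ₘ (b ⊕ₘ c) := by
  rw [odot_comm, odot_comm a]
  refine oplus_right_cancel (z := ∼a) ?_ (sub_le_neg _ _) ?_
  · have h : b ⊙ₘ a ≤ ∼c ⊖ ∼a := sub_le_sub hbc le_rfl
    refine (oplus_le_oplus_right h c).trans ?_
    rw [neg_sub_neg, neg_neg, sub_oplus_cancel ((le_neg_comm hbc).trans (neg_le_comm hab))]
  · rw [odot, odot, sub_oplus_cancel (hab.trans (le_oplus_right _ _))]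
    have := sub_oplus_cancel hab
    calc b ⊖ ∼a ⊕ₘ c ⊕ₘ ∼a = b ⊖ ∼a ⊕ₘ ∼a ⊕ₘ c := by ac_rfl
      _ = b ⊕ₘ c := by rw [this]

theorem oplus_odot_of_le {a b c : A} (hab : a ≤ ∼b) (hbc : b ≤ ∼c) :
    (a ⊕ₘ b) ⊙ₘ c = a ⊙ₘ (b ⊕ₘ c) := by
  have h : ∼c = b ⊕ₘ (∼c ⊖ b) := by rw [oplus_comm, sub_oplus_cancel hbc]
  rw [odot, h, ← sub_sub, oplus_sub_cancel hab, odot, neg_oplus, odot_comm, odot, neg_neg]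

theorem odot_oplus_of_neg_le {a b c : A} (hab : ∼b ≤ a) (hbc : ∼c ≤ b) :
    a ⊙ₘ b ⊕ₘ c = a ⊕ₘ b ⊙ₘ c := by
  refine neg_inj ?_
  rw [neg_oplus, neg_odot, neg_oplus, neg_odot]
  exact oplus_odot_of_le (neg_le_neg hab) (neg_le_neg hbc)

end Product

/-- A nontrivial MV-algebra whose natural order is total. -/
class MVChain (C : Type u) extends MVAlgebra C where
  total : ∀ x y : C, x ≤ y ∨ y ≤ x
  zero_ne_neg_zero : (0 : C) ≠ ∼0

local infixl:70 " ⊙ₘ " => MVAlgebra.odot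

/-- Chang's group of an MV-chain `C`, on the set `ℤ × (C \ {1})`. -/
@[ext] structure ChangGroup (C : Type u) [MVChain C] where
  fst : ℤ
  snd : C
  ne_one : snd ≠ ∼0

/-! ### Chang's ordered group of a chain. -/

namespace ChangGroup

variable {C : Type u} [MVChain C]

/-- Totality enters the group construction here: a sum that does not reach `1` is not truncated. -/
theorem le_neg_of_oplus_ne {a b : C} (h : a ⊕ₘ b ≠ ∼0) : a ≤ ∼b :=
  (MVChain.total a (∼b)).resolve_right fun h' =>
    h (by rw [oplus_comm]; exact oplus_eq_neg_zero_iff.2 h')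

theorem ne_neg_zero_of_le {a b : C} (h : a ≤ b) (hb : b ≠ ∼0) : a ≠ ∼0 := by
  rintro rfl
  exact hb (le_antisymm (le_neg_zero b) h)

instance : Zero (ChangGroup C) := ⟨⟨0, 0, MVChain.zero_ne_neg_zero⟩⟩

-- The pair `(m, a)` stands for `m` units plus `a`, so `a = 1` is excluded to make it unique. A
-- carry occurs exactly when `a ⊕ b = 1`, and the remainder is then `a ⊙ b`.
open Classical in
noncomputable instance : Add (ChangGroup C) where
  add p q := if h : p.snd ⊕ₘ q.snd = ∼0 then
      ⟨p.fst + q.fst + 1, p.snd ⊙ₘ q.snd, ne_neg_zero_of_le (odot_le_left _ _) p.ne_one⟩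
    else ⟨p.fst + q.fst, p.snd ⊕ₘ q.snd, h⟩

open Classical in
noncomputable instance : Neg (ChangGroup C) where
  neg p := if h : p.snd = 0 then ⟨-p.fst, 0, MVChain.zero_ne_neg_zero⟩
    else ⟨-p.fst - 1, ∼p.snd, fun h' => h (neg_inj h')⟩

@[simp] theorem zero_fst : (0 : ChangGroup C).fst = 0 := rfl

@[simp] theorem zero_snd : (0 : ChangGroup C).snd = 0 := rfl

theorem add_fst_of_eq {p q : ChangGroup C} (h : p.snd ⊕ₘ q.snd = ∼0) :
    (p + q).fst = p.fst + q.fst + 1 := congrArg fst (dif_pos h)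

theorem add_snd_of_eq {p q : ChangGroup C} (h : p.snd ⊕ₘ q.snd = ∼0) :
    (p + q).snd = p.snd ⊙ₘ q.snd := congrArg snd (dif_pos h)

theorem add_fst_of_ne {p q : ChangGroup C} (h : p.snd ⊕ₘ q.snd ≠ ∼0) :
    (p + q).fst = p.fst + q.fst := congrArg fst (dif_neg h)

theorem add_snd_of_ne {p q : ChangGroup C} (h : p.snd ⊕ₘ q.snd ≠ ∼0) :
    (p + q).snd = p.snd ⊕ₘ q.snd := congrArg snd (dif_neg h)

protected theorem add_comm (p q : ChangGroup C) : p + q = q + p := by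
  by_cases h : p.snd ⊕ₘ q.snd = ∼0
  · have h' := h
    rw [oplus_comm] at h'
    ext
    · rw [add_fst_of_eq h, add_fst_of_eq h', add_comm q.fst]
    · rw [add_snd_of_eq h, add_snd_of_eq h', odot_comm]
  · have h' := h
    rw [oplus_comm] at h'
    ext
    · rw [add_fst_of_ne h, add_fst_of_ne h', add_comm q.fst]
    · rw [add_snd_of_ne h, add_snd_of_ne h', oplus_comm]

theorem add_assoc_of_eq_of_ne {p q r : ChangGroup C} (h₁ : p.snd ⊕ₘ q.snd = ∼0)
    (h₂ : q.snd ⊕ₘ r.snd ≠ ∼0) : p + q + r = p + (q + r) := by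
  have key := odot_oplus_of_le (oplus_eq_neg_zero_iff.1 h₁) (le_neg_of_oplus_ne h₂)
  have h₃ : (p + q).snd ⊕ₘ r.snd ≠ ∼0 := by
    rw [add_snd_of_eq h₁, key, odot_comm]
    exact ne_neg_zero_of_le (odot_le_left _ _) h₂
  have h₄ : p.snd ⊕ₘ (q + r).snd = ∼0 := by
    rw [add_snd_of_ne h₂, oplus_assoc, h₁, neg_zero_oplus]
  ext
  · rw [add_fst_of_ne h₃, add_fst_of_eq h₄, add_fst_of_eq h₁, add_fst_of_ne h₂]
    ring
  · rw [add_snd_of_ne h₃, add_snd_of_eq h₄, add_snd_of_eq h₁, add_snd_of_ne h₂, key]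

protected theorem add_assoc (p q r : ChangGroup C) : p + q + r = p + (q + r) := by
  by_cases h₁ : p.snd ⊕ₘ q.snd = ∼0 <;> by_cases h₂ : q.snd ⊕ₘ r.snd = ∼0
  · have key : p.snd ⊙ₘ q.snd ⊕ₘ r.snd = p.snd ⊕ₘ q.snd ⊙ₘ r.snd :=
      odot_oplus_of_neg_le (neg_le_comm (oplus_eq_neg_zero_iff.1 h₁))
        (neg_le_comm (oplus_eq_neg_zero_iff.1 h₂))
    rw [← add_snd_of_eq h₁, ← add_snd_of_eq h₂] at key
    by_cases h₃ : (p + q).snd ⊕ₘ r.snd = ∼0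
    · have h₄ := key.symm.trans h₃
      ext
      · rw [add_fst_of_eq h₃, add_fst_of_eq h₄, add_fst_of_eq h₁, add_fst_of_eq h₂]
        ring
      · rw [add_snd_of_eq h₃, add_snd_of_eq h₄, add_snd_of_eq h₁, add_snd_of_eq h₂, odot_assoc]
    · have h₄ : p.snd ⊕ₘ (q + r).snd ≠ ∼0 := key ▸ h₃
      ext
      · rw [add_fst_of_ne h₃, add_fst_of_ne h₄, add_fst_of_eq h₁, add_fst_of_eq h₂]
        ring
      · rw [add_snd_of_ne h₃, add_snd_of_ne h₄, key]
  · exact add_assoc_of_eq_of_ne h₁ h₂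
  -- The other mixed carry pattern is the mirror image, by commutativity.
  · have := add_assoc_of_eq_of_ne (p := r) (q := q) (r := p) (by rwa [oplus_comm])
      (by rwa [oplus_comm])
    rw [ChangGroup.add_comm p q, ChangGroup.add_comm _ r, ← this, ChangGroup.add_comm r q,
      ChangGroup.add_comm p]
  · have key : p.snd ⊕ₘ q.snd ⊕ₘ r.snd = p.snd ⊕ₘ (q.snd ⊕ₘ r.snd) := (oplus_assoc _ _ _).symm
    rw [← add_snd_of_ne h₁, ← add_snd_of_ne h₂] at key
    by_cases h₃ : (p + q).snd ⊕ₘ r.snd = ∼0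
    · have h₄ := key.symm.trans h₃
      ext
      · rw [add_fst_of_eq h₃, add_fst_of_eq h₄, add_fst_of_ne h₁, add_fst_of_ne h₂]
        ring
      · rw [add_snd_of_eq h₃, add_snd_of_eq h₄, add_snd_of_ne h₁, add_snd_of_ne h₂]
        exact oplus_odot_of_le (le_neg_of_oplus_ne h₁) (le_neg_of_oplus_ne h₂)
    · have h₄ : p.snd ⊕ₘ (q + r).snd ≠ ∼0 := key ▸ h₃
      ext
      · rw [add_fst_of_ne h₃, add_fst_of_ne h₄, add_fst_of_ne h₁, add_fst_of_ne h₂]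
        ring
      · rw [add_snd_of_ne h₃, add_snd_of_ne h₄, key]

protected theorem zero_add (p : ChangGroup C) : 0 + p = p := by
  have h : (0 : ChangGroup C).snd ⊕ₘ p.snd ≠ ∼0 := by
    rw [zero_snd, zero_oplus]
    exact p.ne_one
  ext
  · rw [add_fst_of_ne h, zero_fst, zero_add]
  · rw [add_snd_of_ne h, zero_snd, zero_oplus]

theorem neg_of_eq {p : ChangGroup C} (h : p.snd = 0) :
    -p = ⟨-p.fst, 0, MVChain.zero_ne_neg_zero⟩ := dif_pos h

theorem neg_of_ne {p : ChangGroup C} (h : p.snd ≠ 0) :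
    -p = ⟨-p.fst - 1, ∼p.snd, fun h' => h (neg_inj h')⟩ := dif_neg h

protected theorem neg_add_cancel (p : ChangGroup C) : -p + p = 0 := by
  by_cases h : p.snd = 0
  · have h' : (-p).snd ⊕ₘ p.snd ≠ ∼0 := by
      rw [neg_of_eq h, h, oplus_zero]
      exact MVChain.zero_ne_neg_zero
    ext
    · rw [add_fst_of_ne h', neg_of_eq h, zero_fst, neg_add_cancel]
    · rw [add_snd_of_ne h', neg_of_eq h, h, oplus_zero, zero_snd]
  · have h' : (-p).snd ⊕ₘ p.snd = ∼0 := by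
      rw [neg_of_ne h]
      exact neg_oplus_self _
    ext
    · rw [add_fst_of_eq h', neg_of_ne h, zero_fst]
      ring
    · rw [add_snd_of_eq h', neg_of_ne h, zero_snd, neg_odot_self]

noncomputable instance : AddCommGroup (ChangGroup C) where
  add_assoc := ChangGroup.add_assoc
  zero_add := ChangGroup.zero_add
  add_zero p := by rw [ChangGroup.add_comm, ChangGroup.zero_add]
  neg_add_cancel := ChangGroup.neg_add_cancel
  add_comm := ChangGroup.add_comm
  nsmul := nsmulRec
  zsmul := zsmulRec

variable (C) in
/-- The cone of the elements of Chang's group with nonnegative integer part. -/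
def cone : AddGroupCone (ChangGroup C) where
  carrier := {p | 0 ≤ p.fst}
  add_mem' {p q} hp hq := by
    simp only [Set.mem_ofPred_eq] at hp hq ⊢
    by_cases h : p.snd ⊕ₘ q.snd = ∼0
    · rw [add_fst_of_eq h]
      omega
    · rw [add_fst_of_ne h]
      omega
  zero_mem' := le_refl (0 : ℤ)
  eq_zero_of_mem_of_neg_mem' {p} hp hn := by
    change 0 ≤ p.fst at hp
    change 0 ≤ (-p).fst at hn
    by_cases h : p.snd = 0
    · rw [neg_of_eq h] at hn
      ext
      · simp only [zero_fst] at hn ⊢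
        omega
      · exact h
    · rw [neg_of_ne h] at hn
      simp only at hn
      omega

theorem mem_cone {p : ChangGroup C} : p ∈ cone C ↔ 0 ≤ p.fst := ⟨fun h => h, fun h => h⟩

instance : HasMemOrNegMem (cone C) where
  mem_or_neg_mem p := by
    rw [mem_cone, mem_cone]
    by_cases h : p.snd = 0
    · rw [neg_of_eq h]
      simp only
      omega
    · rw [neg_of_ne h]
      simp only
      omega

open Classical in
noncomputable instance : LinearOrder (ChangGroup C) := LinearOrder.mkOfAddGroupCone (cone C)

instance : IsOrderedAddMonoid (ChangGroup C) :=
  IsOrderedAddMonoid.mkOfCone (cone C)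

theorem nonneg_iff {p : ChangGroup C} : 0 ≤ p ↔ 0 ≤ p.fst := by
  have : 0 ≤ p ↔ p - 0 ∈ cone C := Iff.rfl
  rw [this, sub_zero, mem_cone]

open Classical in
/-- The canonical map of an MV-chain to its Chang group. -/
noncomputable def of (a : C) : ChangGroup C :=
  if h : a = ∼0 then ⟨1, 0, MVChain.zero_ne_neg_zero⟩ else ⟨0, a, h⟩

theorem of_neg_zero : of (∼0 : C) = ⟨1, 0, MVChain.zero_ne_neg_zero⟩ := dif_pos rfl

theorem of_of_ne {a : C} (h : a ≠ ∼0) : of a = ⟨0, a, h⟩ := dif_neg h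

theorem of_zero : of (0 : C) = 0 := of_of_ne MVChain.zero_ne_neg_zero

theorem of_nonneg (a : C) : 0 ≤ of a := by
  rw [nonneg_iff]
  by_cases h : a = ∼0
  · rw [h, of_neg_zero]
    exact zero_le_one
  · rw [of_of_ne h]

theorem of_neg_zero_pos : 0 < of (∼0 : C) := by
  refine lt_of_le_of_ne (of_nonneg _) fun h => ?_
  have := congrArg fst h
  rw [of_neg_zero] at this
  exact zero_ne_one this

theorem of_injective : Function.Injective (of : C → ChangGroup C) := by
  intro a b h
  by_cases ha : a = ∼0 <;> by_cases hb : b = ∼0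
  · rw [ha, hb]
  · rw [ha, of_neg_zero, of_of_ne hb] at h
    exact absurd (congrArg fst h) one_ne_zero
  · rw [hb, of_neg_zero, of_of_ne ha] at h
    exact absurd (congrArg fst h) zero_ne_one
  · rw [of_of_ne ha, of_of_ne hb] at h
    exact congrArg snd h

theorem of_oplus_of_ne {a b : C} (h : a ⊕ₘ b ≠ ∼0) : of (a ⊕ₘ b) = of a + of b := by
  have ha : a ≠ ∼0 := ne_neg_zero_of_le (le_oplus_right a b) h
  have hb : b ≠ ∼0 := ne_neg_zero_of_le (le_oplus_left a b) h
  rw [of_of_ne h, of_of_ne ha, of_of_ne hb]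
  ext
  · rw [add_fst_of_ne h, add_zero]
  · rw [add_snd_of_ne h]

/-- The product records what truncation discards: `a` and `b` add up to one unit plus `a ⊙ b`. -/
theorem of_add_of_of_eq {a b : C} (h : a ⊕ₘ b = ∼0) :
    of a + of b = of ∼0 + of (a ⊙ₘ b) := by
  by_cases ha : a = ∼0
  · rw [ha, neg_zero_odot]
  by_cases hb : b = ∼0
  · rw [hb, odot_comm, neg_zero_odot, add_comm]
  have hab := ne_neg_zero_of_le (odot_le_left a b) ha
  have h' : 0 ⊕ₘ a ⊙ₘ b ≠ ∼0 := by rwa [zero_oplus]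
  rw [of_of_ne ha, of_of_ne hb, of_neg_zero, of_of_ne hab]
  ext
  · rw [add_fst_of_eq h, add_fst_of_ne h']
    ring
  · rw [add_snd_of_eq h, add_snd_of_ne h', zero_oplus]

theorem of_neg (a : C) : of ∼a = of ∼0 - of a := by
  have := of_add_of_of_eq (neg_oplus_self a)
  rw [neg_odot_self, of_zero, add_zero] at this
  rw [← this, add_sub_cancel_right]

end ChangGroup

end MVAlgebra

/-! ### Partial maps on finite sets and their gluing. -/

namespace MVAlgebra

local infixl:65 " ⊕ₘ " => MVAlgebra.oplus
local prefix:max "∼" => MVAlgebra.neg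
local infixl:70 " ⊙ₘ " => MVAlgebra.odot
attribute [local instance] toLattice

/-- Finitely many elements of an MV-chain are mapped to `ℚ ∩ [0, 1]` compatibly with the
operations, separating two given elements. -/
theorem exists_rat_partial_hom_of_chain {C : Type u} [MVChain C] (F : Finset C) {a b : C}
    (hab : a ≠ b) :
    ∃ h : C → Set.Icc (0 : ℚ) 1, (∀ x ∈ F, ∀ y ∈ F, h (x ⊕ₘ y) = h x ⊕ₘ h y) ∧
      (∀ x ∈ F, h ∼x = ∼(h x)) ∧ h 0 = 0 ∧ h a ≠ h b := by
  classical
  let E : Finset C := {0, a, b} ∪ F ∪ F.image neg ∪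
    ((F ×ˢ F).image fun p => p.1 ⊕ₘ p.2) ∪ ((F ×ˢ F).image fun p => p.1 ⊙ₘ p.2)
  have hE₁ : ∀ x ∈ ({0, a, b} : Finset C), x ∈ E := fun x hx => by
    simp only [E, Finset.mem_union]
    tauto
  have hE₂ : ∀ x ∈ F, x ∈ E ∧ ∼x ∈ E := fun x hx => by
    have := Finset.mem_image_of_mem neg hx
    simp only [E, Finset.mem_union]
    tauto
  have hE₃ : ∀ x ∈ F, ∀ y ∈ F, x ⊕ₘ y ∈ E ∧ x ⊙ₘ y ∈ E := fun x hx y hy => by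
    have h₁ := Finset.mem_image_of_mem (fun p : C × C => p.1 ⊕ₘ p.2) (Finset.mk_mem_product hx hy)
    have h₂ := Finset.mem_image_of_mem (fun p : C × C => p.1 ⊙ₘ p.2) (Finset.mk_mem_product hx hy)
    simp only [E, Finset.mem_union]
    tauto
  -- Positivity at the absolute difference separates `a` from `b`, at the unit it permits division,
  -- and at `E` and its negations it puts the normalised values in `[0,1]`.
  obtain ⟨φ, hφ⟩ := exists_addMonoidHom_pos
    (insert |ChangGroup.of a - ChangGroup.of b| (insert (ChangGroup.of (∼0 : C))
      (((E ∪ E.image neg).image ChangGroup.of).filter (0 < ·)))) (by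
    intro t ht
    simp only [Finset.mem_insert, Finset.mem_filter] at ht
    rcases ht with rfl | rfl | ht
    · exact abs_pos.2 (sub_ne_zero.2 (ChangGroup.of_injective.ne hab))
    · exact ChangGroup.of_neg_zero_pos
    · exact ht.2)
  have hu : 0 < φ (ChangGroup.of ∼0) := hφ _ (by simp)
  have hab' : φ (ChangGroup.of a) ≠ φ (ChangGroup.of b) := by
    have h := hφ _ (Finset.mem_insert_self _ _)
    intro h'
    rcases abs_choice (ChangGroup.of a - ChangGroup.of b) with h'' | h'' <;>
    · rw [h''] at h
      simp [h'] at h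
  have hnonneg : ∀ x ∈ E ∪ E.image neg, 0 ≤ φ (ChangGroup.of x) := by
    intro x hx
    rcases (ChangGroup.of_nonneg x).eq_or_lt with h | h
    · rw [← h, map_zero]
    · exact (hφ _ (Finset.mem_insert_of_mem (Finset.mem_insert_of_mem
        (Finset.mem_filter.2 ⟨Finset.mem_image_of_mem _ hx, h⟩)))).le
  let H : C → ℚ := fun x => φ (ChangGroup.of x) / φ (ChangGroup.of ∼0)
  have hneg : ∀ x, H ∼x = 1 - H x := by
    intro x
    simp only [H]
    rw [ChangGroup.of_neg, map_sub, sub_div, div_self hu.ne']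
  have hH : ∀ x ∈ E, H x ∈ Set.Icc (0 : ℚ) 1 := by
    intro x hx
    refine ⟨div_nonneg (hnonneg x (Finset.mem_union_left _ hx)) hu.le, ?_⟩
    have : 0 ≤ H ∼x :=
      div_nonneg (hnonneg _ (Finset.mem_union_right _ (Finset.mem_image_of_mem _ hx))) hu.le
    rw [hneg] at this
    linarith
  have hval : ∀ x ∈ E, ((Set.projIcc (0 : ℚ) 1 zero_le_one (H x) : Set.Icc (0 : ℚ) 1) : ℚ) =
      H x := fun x hx => by rw [Set.projIcc_of_mem _ (hH x hx)]
  -- The projection only makes the map total; on `E` it changes nothing.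
  refine ⟨fun x => Set.projIcc 0 1 zero_le_one (H x), fun x hx y hy => Subtype.ext ?_,
    fun x hx => Subtype.ext ?_, Subtype.ext ?_, fun h => hab' ?_⟩
  · change _ = min 1 (Subtype.val _ + Subtype.val _)
    rw [hval x (hE₂ x hx).1, hval y (hE₂ y hy).1, hval _ (hE₃ x hx y hy).1]
    by_cases h : x ⊕ₘ y = ∼0
    · have h₁ : H x + H y = 1 + H (x ⊙ₘ y) := by
        simp only [H]
        rw [← add_div, ← map_add, ChangGroup.of_add_of_of_eq h, map_add, add_div,
          div_self hu.ne']
      have h₂ := (hH _ (hE₃ x hx y hy).2).1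
      rw [min_eq_left (by linarith), h]
      exact div_self hu.ne'
    · have h₁ : H (x ⊕ₘ y) = H x + H y := by
        simp only [H]
        rw [← add_div, ← map_add, ChangGroup.of_oplus_of_ne h]
      rw [← h₁, min_eq_right (hH _ (hE₃ x hx y hy).1).2]
  · change _ = 1 - Subtype.val _
    rw [hval _ (hE₂ x hx).2, hval x (hE₂ x hx).1, hneg]
  · rw [hval 0 (hE₁ 0 (by simp))]
    simp only [H]
    rw [ChangGroup.of_zero, map_zero, zero_div]
    rfl
  · have h₁ := congrArg Subtype.val h
    simp only at h₁
    rw [hval a (hE₁ a (by simp)), hval b (hE₁ b (by simp))] at h₁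
    exact (div_left_inj' hu.ne').1 h₁

theorem exists_rat_partial_hom {M : Type u} [MVAlgebra M] (F : Finset M) {a b : M}
    (hab : a ≠ b) :
    ∃ h : M → Set.Icc (0 : ℚ) 1, (∀ x ∈ F, ∀ y ∈ F, h (x ⊕ₘ y) = h x ⊕ₘ h y) ∧
      (∀ x ∈ F, h ∼x = ∼(h x)) ∧ h 0 = 0 ∧ h a ≠ h b := by
  classical
  obtain ⟨C, _, π, htotal, hoplus, hneg, hzero, hne⟩ := exists_chain_quotient hab
  have h01 : (0 : C) ≠ ∼0 := by
    intro h
    have hx : ∀ x : C, x = 0 := fun x => le_antisymm ((le_neg_zero x).trans_eq h.symm) (zero_le x)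
    exact hne ((hx _).trans (hx _).symm)
  let _ : MVChain C := { total := htotal, zero_ne_neg_zero := h01 }
  obtain ⟨h, h₁, h₂, h₃, h₄⟩ := exists_rat_partial_hom_of_chain (F.image π) hne
  refine ⟨h ∘ π, fun x hx y hy => ?_, fun x hx => ?_, ?_, h₄⟩
  · simp only [Function.comp_apply, hoplus]
    exact h₁ _ (Finset.mem_image_of_mem π hx) _ (Finset.mem_image_of_mem π hy)
  · simp only [Function.comp_apply, hneg]
    exact h₂ _ (Finset.mem_image_of_mem π hx)
  · simp only [Function.comp_apply, hzero, h₃]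

/-- Finitely many elements of a nontrivial MV-algebra are mapped injectively to
`(ℚ ∩ [0, 1]) ^ ℕ`, compatibly with the operations. -/
theorem exists_pow_rat_partial_embedding {M : Type u} [MVAlgebra M] [Nontrivial M]
    (F : Finset M) :
    ∃ h : M → ℕ → Set.Icc (0 : ℚ) 1, (∀ x ∈ F, ∀ y ∈ F, h (x ⊕ₘ y) = h x ⊕ₘ h y) ∧
      (∀ x ∈ F, h ∼x = ∼(h x)) ∧ h 0 = 0 ∧ Set.InjOn h F := by
  classical
  have key : ∀ p : M × M, ∃ h : M → Set.Icc (0 : ℚ) 1,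
      (∀ x ∈ F, ∀ y ∈ F, h (x ⊕ₘ y) = h x ⊕ₘ h y) ∧
      (∀ x ∈ F, h ∼x = ∼(h x)) ∧ h 0 = 0 ∧ (p.1 ≠ p.2 → h p.1 ≠ h p.2) := by
    rintro ⟨a, b⟩
    by_cases hab : a = b
    -- A diagonal pair has nothing to separate, but its coordinate must still respect the
    -- operations; nontriviality supplies another pair that yields such a map.
    · obtain ⟨c, d, hcd⟩ := exists_pair_ne M
      obtain ⟨h, h₁, h₂, h₃, -⟩ := exists_rat_partial_hom F hcd
      exact ⟨h, h₁, h₂, h₃, fun h => absurd hab h⟩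
    · obtain ⟨h, h₁, h₂, h₃, h₄⟩ := exists_rat_partial_hom F hab
      exact ⟨h, h₁, h₂, h₃, fun _ => h₄⟩
  choose h h₁ h₂ h₃ h₄ using key
  -- Inserting `0` keeps the set of pairs nonempty when `F` is empty, so `ℕ` can enumerate it with
  -- repetitions.
  have : Nonempty (↥(insert 0 F) × ↥(insert 0 F)) :=
    ⟨⟨0, Finset.mem_insert_self _ _⟩, ⟨0, Finset.mem_insert_self _ _⟩⟩
  obtain ⟨e, he⟩ := exists_surjective_nat (↥(insert 0 F) × ↥(insert 0 F))
  refine ⟨fun x n => h ((e n).1, (e n).2) x, fun x hx y hy => funext fun n => h₁ _ x hx y hy,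
    fun x hx => funext fun n => h₂ _ x hx, funext fun n => h₃ _, fun x hx y hy hxy => ?_⟩
  by_contra hne
  obtain ⟨n, hn⟩ := he (⟨x, Finset.mem_insert_of_mem hx⟩, ⟨y, Finset.mem_insert_of_mem hy⟩)
  have := congrFun hxy n
  simp only [hn] at this
  exact h₄ (x, y) hne this

/-- Partial embeddings of the finite subsets of `M` into `B` glue to an embedding into an
ultrapower of `B`. -/
theorem embeds_germ_of_partial {M : Type u} {B : Type v} [MVAlgebra M] [MVAlgebra B]
    {κ : Type u} (hM : #M ≤ #κ) (U : Filter (Finset κ)) [U.NeBot] (hU : ContainsCones U)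
    (hloc : ∀ F : Finset M, ∃ h : M → B, (∀ x ∈ F, ∀ y ∈ F, h (x ⊕ₘ y) = h x ⊕ₘ h y) ∧
      (∀ x ∈ F, h ∼x = ∼(h x)) ∧ h 0 = 0 ∧ Set.InjOn h F) :
    Embeds M (Germ U B) := by
  classical
  obtain ⟨j⟩ := hM
  choose h h₁ h₂ h₃ h₄ using hloc
  let F : Finset κ → Finset M := fun X => X.preimage j j.injective.injOn
  have hF : ∀ {X x}, {j x} ⊆ X → x ∈ F X := fun hX =>
    Finset.mem_preimage.2 (Finset.singleton_subset_iff.1 hX)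
  refine ⟨fun x => ((fun X => h (F X) x : Finset κ → B) : Germ U B), fun x y hxy => ?_,
    fun x y => Germ.coe_eq.2 ?_, fun x => Germ.coe_eq.2 ?_, congrArg _ (funext fun X => h₃ _)⟩
  · obtain ⟨X, ⟨hX, hx⟩, hy⟩ :=
      (((Germ.coe_eq.1 hxy).and (hU {j x})).and (hU {j y})).exists
    exact h₄ _ (hF hx) (hF hy) hX
  · filter_upwards [hU {j x}, hU {j y}] with X hx hy
    exact h₁ _ x (hF hx) y (hF hy)
  · filter_upwards [hU {j x}] with X hx
    exact h₂ _ x (hF hx)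

theorem Embeds.trans {A : Type*} {B : Type*} {C : Type*} [MVAlgebra A] [MVAlgebra B]
    [MVAlgebra C] (h : Embeds A B) (h' : Embeds B C) : Embeds A C := by
  obtain ⟨f, hf, h₁, h₂, h₃⟩ := h
  obtain ⟨g, hg, h₁', h₂', h₃'⟩ := h'
  exact ⟨g ∘ f, hg.comp hf, fun x y => by simp only [Function.comp_apply, h₁, h₁'],
    fun x => by simp only [Function.comp_apply, h₂, h₂'],
    by simp only [Function.comp_apply, h₃, h₃']⟩

theorem Embeds.power {A : Type*} {B : Type*} [MVAlgebra A] [MVAlgebra B] (h : Embeds A B)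
    (J : Type*) : Embeds (J → A) (J → B) := by
  obtain ⟨f, hf, h₁, h₂, h₃⟩ := h
  exact ⟨fun x j => f (x j), fun x y hxy => funext fun j => hf (congrFun hxy j),
    fun x y => funext fun j => h₁ _ _, fun x => funext fun j => h₂ _, funext fun j => h₃⟩

theorem Embeds.germ {A : Type*} {B : Type*} [MVAlgebra A] [MVAlgebra B] (h : Embeds A B)
    {I : Type*} (U : Filter I) : Embeds (Germ U A) (Germ U B) := by
  obtain ⟨f, hf, h₁, h₂, h₃⟩ := h
  refine ⟨Germ.map f, fun x y => Germ.inductionOn₂ x y fun a b hab => Germ.coe_eq.2 ?_,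
    fun x y => Germ.inductionOn₂ x y fun a b => congrArg _ (funext fun i => h₁ _ _),
    fun x => Germ.inductionOn x fun a => congrArg _ (funext fun i => h₂ _),
    congrArg _ (funext fun i => h₃)⟩
  exact (Germ.coe_eq.1 hab).mono fun i hi => hf hi

theorem embeds_unitIcc_rat_real : Embeds (Set.Icc (0 : ℚ) 1) (Set.Icc (0 : ℝ) 1) := by
  refine ⟨fun x => ⟨(x.1 : ℝ), by exact_mod_cast x.2.1, by exact_mod_cast x.2.2⟩,
    fun x y hxy => Subtype.ext ?_, fun x y => Subtype.ext ?_, fun x => Subtype.ext ?_,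
    Subtype.ext ?_⟩
  · exact Rat.cast_injective (α := ℝ) (congrArg Subtype.val hxy)
  · change ((min 1 (x.1 + y.1) : ℚ) : ℝ) = min 1 ((x.1 : ℝ) + (y.1 : ℝ))
    push_cast
    rfl
  · change ((1 - x.1 : ℚ) : ℝ) = 1 - (x.1 : ℝ)
    push_cast
    rfl
  · exact Rat.cast_zero

end MVAlgebra

/-! ### Regularity and cardinality of the ultrapower. -/

section Ultrafilter

variable {κ : Type u}

theorem exists_ultrafilter_containsCones (κ : Type u) :
    ∃ U : Ultrafilter (Finset κ), ContainsCones (U : Filter (Finset κ)) :=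
  ⟨Ultrafilter.of atTop, fun X => Ultrafilter.of_le atTop (Ici_mem_atTop X)⟩

/-- The cones over singletons are the regular family: `Y` lies in the cone over `{k}` only when `k ∈
Y`. -/
theorem ContainsCones.isRegularFilter {U : Filter (Finset κ)} [U.NeBot] (hU : ContainsCones U) :
    IsRegularFilter #κ U := by
  refine ⟨inferInstance, Set.range fun k : κ => {Y : Finset κ | {k} ⊆ Y}, ?_, ?_, fun Y => ?_⟩
  · rintro _ ⟨k, rfl⟩
    exact hU {k}
  · refine mk_range_eq _ fun k l hkl => ?_
    have h : ({k} : Finset κ) ∈ {Y : Finset κ | {l} ⊆ Y} := by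
      rw [← show {Y : Finset κ | {k} ⊆ Y} = {Y : Finset κ | {l} ⊆ Y} from hkl]
      exact Finset.Subset.refl _
    exact (Finset.singleton_subset_singleton.1 h).symm
  · refine (Y.finite_toSet.image fun k : κ => {Y : Finset κ | {k} ⊆ Y}).subset ?_
    rintro _ ⟨⟨k, rfl⟩, hk⟩
    exact ⟨k, Finset.singleton_subset_iff.1 hk, rfl⟩

/-- Each finite power `X → Bool` injects into `B`. Two functions with equal germs have equal
restrictions to some `X` containing any prescribed `k`, hence agree at `k`. -/
theorem ContainsCones.two_power_le_mk_germ {U : Filter (Finset κ)} [U.NeBot]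
    (hU : ContainsCones U) (B : Type) [Infinite B] : 2 ^ #κ ≤ #(Germ U B) := by
  have key : ∀ X : Finset κ, ∃ e : (X → Bool) → B, Function.Injective e := fun X => by
    obtain ⟨e, he⟩ := exists_injective_nat (X → Bool)
    exact ⟨_, (Infinite.natEmbedding B).injective.comp he⟩
  choose e he using key
  let g : (κ → Bool) → Germ U B := fun f =>
    ((fun X => e X fun k => f k : Finset κ → B) : Germ U B)
  have hg : Function.Injective g := by
    intro f f' hff'
    funext k
    obtain ⟨X, hX, hk⟩ := ((Germ.coe_eq.1 hff').and (hU {k})).exists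
    exact congrFun (he X hX) ⟨k, Finset.singleton_subset_iff.1 hk⟩
  simpa using mk_le_of_injective hg

end Ultrafilter

theorem mk_germ_finset_le {κ : Type u} (hκ : ℵ₀ ≤ #κ) (U : Filter (Finset κ)) (B : Type)
    (hB : #B ≤ 𝔠) : #(Germ U B) ≤ 2 ^ #κ := by
  have : Infinite κ := infinite_iff.2 hκ
  have hB' : lift.{u} #B ≤ 2 ^ ℵ₀ := by
    rw [two_power_aleph0, lift_le_continuum]
    exact hB
  calc #(Germ U B) ≤ #(Finset κ → B) := mk_quotient_le
    _ = lift.{u} #B ^ #κ := by rw [mk_arrow, mk_finset_of_infinite, lift_uzero]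
    _ ≤ (2 ^ ℵ₀) ^ #κ := power_le_power_right hB'
    _ = 2 ^ #κ := by rw [← power_mul, aleph0_mul_eq hκ]

theorem mk_nat_arrow_le_continuum (B : Type) [Countable B] : #(ℕ → B) ≤ 𝔠 := by
  rw [mk_arrow, lift_uzero, lift_uzero, mk_nat, ← aleph0_power_aleph0]
  exact power_le_power_right mk_le_aleph0

theorem theorem12 (α : Cardinal.{u}) (hα : ℵ₀ ≤ α) (κ : Type u) (hκ : #κ = α) :
    (∃ U : Ultrafilter (Finset κ), ContainsCones (U : Filter (Finset κ))) ∧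
    (∀ U : Ultrafilter (Finset κ), ContainsCones (U : Filter (Finset κ)) →
      IsRegularFilter α (U : Filter (Finset κ)) ∧
      (∀ (M : Type u) [MVAlgebra M] [Nontrivial M], #M ≤ α →
        MVAlgebra.Embeds M (Germ (U : Filter (Finset κ)) (ℕ → Set.Icc (0 : ℚ) 1)) ∧
        MVAlgebra.Embeds M (Germ (U : Filter (Finset κ)) (ℕ → Set.Icc (0 : ℝ) 1))) ∧
      #(Germ (U : Filter (Finset κ)) (ℕ → Set.Icc (0 : ℚ) 1)) = 2 ^ α) ∧
    (∃ (N : Type u) (_ : MVAlgebra N), #N = 2 ^ α ∧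
      ∀ (M : Type u) [MVAlgebra M] [Nontrivial M], #M ≤ α → MVAlgebra.Embeds M N) := by
  subst hκ
  -- Needed for the power `ℕ → ℚ ∩ [0,1]` to be infinite in the lower cardinality bound.
  have : Nontrivial (Set.Icc (0 : ℚ) 1) := ⟨0, 1, fun h => zero_ne_one (congrArg Subtype.val h)⟩
  have hembeds : ∀ U : Ultrafilter (Finset κ), ContainsCones (U : Filter (Finset κ)) →
      ∀ (M : Type u) [MVAlgebra M] [Nontrivial M], #M ≤ #κ →
        MVAlgebra.Embeds M (Germ (U : Filter (Finset κ)) (ℕ → Set.Icc (0 : ℚ) 1)) :=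
    fun U hU M _ _ hM =>
      MVAlgebra.embeds_germ_of_partial hM _ hU MVAlgebra.exists_pow_rat_partial_embedding
  have hcard : ∀ U : Ultrafilter (Finset κ), ContainsCones (U : Filter (Finset κ)) →
      #(Germ (U : Filter (Finset κ)) (ℕ → Set.Icc (0 : ℚ) 1)) = 2 ^ #κ := fun U hU =>
    le_antisymm (mk_germ_finset_le hα _ _ (mk_nat_arrow_le_continuum _)) (hU.two_power_le_mk_germ _)
  obtain ⟨U, hU⟩ := exists_ultrafilter_containsCones κ
  exact ⟨⟨U, hU⟩, fun U hU => ⟨hU.isRegularFilter, fun M _ _ hM => ⟨hembeds U hU M hM,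
    (hembeds U hU M hM).trans ((MVAlgebra.embeds_unitIcc_rat_real.power ℕ).germ _)⟩,
    hcard U hU⟩, _, _, hcard U hU, hembeds U hU⟩
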